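/- All graphs are finite, simple and undirected. For a connected graph $G$ let $D(G)$ be its distance matrix and $\lambda_1(D(G))$ the largest eigenvalue of $D(G)$. For a vertex set $S$ let $c(G-S)$ be the number of connected components of $G-S$, and call $S$ a cut set if $G-S$ is disconnected. The toughness of $G$ is $\tau(G)=\min\{|S|/c(G-S) : S \text{ is a cut set of } G\}$, with $\tau(G)=\infty$ if $G$ is complete, and $G$ is called $t$-tough if $\tau(G)\ge t$. Write $G_1+G_2$ for the disjoint union, $kG_1$ for the disjoint union of $k$ copies of $G_1$, and $G_1\vee G_2$ for the join (the disjoint union together with all edges between $G_1$ and $G_2$). Let $G$ be a connected graph of order $n$. (i) Let $t$ be a positive integer and $n\ge 4t^2+10t$. If $\lambda_1(D(G))\le\lambda_1(D(K_{2t-1}\vee(K_{n-2t}+K_1)))$, then $G$ is $t$-tough unless $G\cong K_{2t-1}\vee(K_{n-2t}+K_1)$, in which case $G$ is not $t$-tough. (ii) Let $t$ be a real number such that $\frac1t$ is a positive integer, and let $n\ge 2t+\frac{9}{2t}+\frac92$. If $\lambda_1(D(G))\le\lambda_1(D(K_1\vee(K_{n-1-\frac1t}+\frac1t K_1)))$,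 then $G$ is $t$-tough unless $G\cong K_1\vee(K_{n-1-\frac1t}+\frac1t K_1)$, in which case $G$ is not $t$-tough. -/

import Mathlib

namespace SimpleGraph

/-- The join `G ∨ H`: the disjoint union of `G` and `H` together with all edges between them. -/
def join {V W : Type*} (G : SimpleGraph V) (H : SimpleGraph W) : SimpleGraph (V ⊕ W) :=
  (G ⊕g H) ⊔ completeBipartiteGraph V W

/-- The distance matrix `D(G)`. -/
noncomputable def distMatrix {V : Type*} (G : SimpleGraph V) : Matrix V V ℝ :=
  Matrix.of fun u v => (G.dist u v : ℝ)

theorem distMatrix_isHermitian {V : Type*} (G : SimpleGraph V) : G.distMatrix.IsHermitian := by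
  ext u v
  simp [distMatrix, dist_comm]

/-- The distance spectral radius `λ₁(D(G))`: the largest eigenvalue of the distance matrix
(a maximum over a finite family, nonempty as soon as `G` has a vertex). -/
noncomputable def distSpectralRadius {V : Type*} [Fintype V] [DecidableEq V]
    (G : SimpleGraph V) : ℝ :=
  ⨆ i, G.distMatrix_isHermitian.eigenvalues i

/-- `c(G - S)`: the number of connected components of the graph obtained by deleting `S`. -/
noncomputable def numCompDelete {V : Type*} (G : SimpleGraph V) (S : Finset V) : ℕ :=
  Nat.card (G.induce ((S : Set V)ᶜ)).ConnectedComponent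

/-- `S` is a cut set of vertices: `G - S` is disconnected (has two vertices that are not joined
by a walk). -/
def IsCutSet {V : Type*} (G : SimpleGraph V) (S : Finset V) : Prop :=
  ¬ (G.induce ((S : Set V)ᶜ)).Preconnected

/-- The toughness `τ(G) = min {|S| / c(G - S) : S a cut set of G}`. A complete graph has no
cut set, and its toughness is `⊤`. -/
noncomputable def toughness {V : Type*} (G : SimpleGraph V) : EReal :=
  ⨅ (S : Finset V) (_ : G.IsCutSet S), (((S.card : ℝ) / (G.numCompDelete S : ℝ) : ℝ) : EReal)

/-- `G` is `t`-tough if `τ(G) ≥ t`. -/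
def IsTough {V : Type*} (G : SimpleGraph V) (t : ℝ) : Prop :=
  (t : EReal) ≤ G.toughness

/-- The graph `K_s ∨ (K_m + k K₁)`. -/
def cliqueJoin (s m k : ℕ) : SimpleGraph (Fin s ⊕ (Fin m ⊕ Fin k)) :=
  join (completeGraph (Fin s)) (completeGraph (Fin m) ⊕g (⊥ : SimpleGraph (Fin k)))

end SimpleGraph

/-! If `G` is not `t`-tough, some `S` leaves `c ≥ 2` components with `|S| < t * c`. Write `s = |S|`.

When `G - S` has few components (`c = 2` in (i), `s = 1` in (ii)), `G` is compared with the extremal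
graph through the Perron vector of the latter, transported by a bijection of the vertices
(`Connected.iso_cliqueJoin_of_coloring`). A vertex of the clique part may be adjacent to one
"isolated" vertex, which shortens one distance by 1. But it then lies in a different component from
two fixed clique vertices, which lengthens two distances by at least 1. As the Perron entries
satisfy `p < 2 * q`, the exchange is a strict gain, so the spectral hypothesis excludes it. Then no
distance is shorter than in the extremal graph, hence all are equal.

Otherwise the all-ones vector gives `λ₁ ≥ n - 1 + (c - 1) * (2 * (n - s) - c) / n`
(`Connected.le_distSpectralRadius_mul_card`), while a two-valued test vector bounds the extremal
radius from above (`cliqueJoin_distSpectralRadius_lt`). The assumed size of `n` makes the two bounds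
contradict each other. -/

namespace Matrix.IsHermitian

/-! ### Rayleigh quotients of real symmetric matrices. -/

variable {ι : Type*} [Fintype ι] [DecidableEq ι] {A : Matrix ι ι ℝ}

theorem posSemidef_smul_one_sub (hA : A.IsHermitian) :
    ((⨆ i, hA.eigenvalues i) • (1 : Matrix ι ι ℝ) - A).PosSemidef := by
  set μ := ⨆ i, hA.eigenvalues i with hμ
  have hD : (diagonal fun i => μ - hA.eigenvalues i).PosSemidef :=
    PosSemidef.diagonal fun i => sub_nonneg.2 (le_ciSup (Set.finite_range _).bddAbove i)
  have hU := hD.mul_mul_conjTranspose_same (hA.eigenvectorUnitary : Matrix ι ι ℝ)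
  have h1 : (diagonal fun i => μ - hA.eigenvalues i) =
      μ • (1 : Matrix ι ι ℝ) - diagonal (RCLike.ofReal ∘ hA.eigenvalues) := by
    ext i j
    by_cases h : i = j <;> simp [diagonal, h]
  have h2 := hA.spectral_theorem
  rw [Unitary.conjStarAlgAut_apply] at h2
  rw [h1, mul_sub, sub_mul, ← star_eq_conjTranspose] at hU
  convert hU using 2
  simp

theorem dotProduct_mulVec_le (hA : A.IsHermitian) (x : ι → ℝ) :
    x ⬝ᵥ A *ᵥ x ≤ (⨆ i, hA.eigenvalues i) * (x ⬝ᵥ x) := by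
  have := hA.posSemidef_smul_one_sub.dotProduct_mulVec_nonneg x
  simpa [sub_mulVec, smul_mulVec] using this

theorem mulVec_eq_of_dotProduct_mulVec_eq (hA : A.IsHermitian) {x : ι → ℝ}
    (hx : x ⬝ᵥ A *ᵥ x = (⨆ i, hA.eigenvalues i) * (x ⬝ᵥ x)) :
    A *ᵥ x = (⨆ i, hA.eigenvalues i) • x := by
  have := (hA.posSemidef_smul_one_sub.dotProduct_mulVec_zero_iff x).1
    (by simp [sub_mulVec, smul_mulVec, hx])
  simpa [sub_mulVec, smul_mulVec, sub_eq_zero, eq_comm] using this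

theorem exists_mulVec_eq_iSup_smul [Nonempty ι] (hA : A.IsHermitian) :
    ∃ x : ι → ℝ, x ≠ 0 ∧ A *ᵥ x = (⨆ i, hA.eigenvalues i) • x := by
  obtain ⟨i, hi⟩ := exists_eq_ciSup_of_finite (f := hA.eigenvalues)
  refine ⟨hA.eigenvectorBasis i, ?_, ?_⟩
  · intro h
    exact hA.eigenvectorBasis.orthonormal.ne_zero i (by ext j; exact congrFun h j)
  · rw [hA.mulVec_eigenvectorBasis, hi]

end Matrix.IsHermitian

/-! ### Perron vector and spectral bounds for the distance matrix. -/

namespace SimpleGraph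

variable {V : Type*} [Fintype V]

theorem distMatrix_mulVec (G : SimpleGraph V) (x : V → ℝ) (u : V) :
    (G.distMatrix.mulVec x) u = ∑ v, (G.dist u v : ℝ) * x v := by
  simp [distMatrix, Matrix.mulVec, dotProduct]

variable [DecidableEq V] {G : SimpleGraph V}

/-- The Rayleigh quotient bound for the distance matrix. -/
theorem sum_dist_mul_le (G : SimpleGraph V) (x : V → ℝ) :
    ∑ u, ∑ v, (G.dist u v : ℝ) * x u * x v ≤ G.distSpectralRadius * ∑ u, x u ^ 2 := by
  have := G.distMatrix_isHermitian.dotProduct_mulVec_le x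
  simp only [dotProduct, distMatrix_mulVec, Finset.mul_sum (Finset.univ), ← sq] at this
  rw [distSpectralRadius, Finset.mul_sum]
  refine le_trans (le_of_eq ?_) this
  exact Finset.sum_congr rfl fun u _ => Finset.sum_congr rfl fun v _ => by ring

/-- The Perron vector of the distance matrix of a connected graph. -/
theorem Connected.exists_perronVector [Nontrivial V] (hG : G.Connected) :
    ∃ x : V → ℝ, (∀ u, 0 < x u) ∧
      ∀ u, ∑ v, (G.dist u v : ℝ) * x v = G.distSpectralRadius * x u := by
  obtain ⟨z, hz0, hz⟩ := G.distMatrix_isHermitian.exists_mulVec_eq_iSup_smul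
  -- Distances are nonnegative, so passing from `z` to `|z|` cannot decrease the quadratic form.
  -- Hence `|z|` is also a maximizer, and so an eigenvector.
  have hle : G.distSpectralRadius * ∑ u, z u ^ 2 ≤
      ∑ u, ∑ v, (G.dist u v : ℝ) * |z u| * |z v| := by
    have h1 : G.distSpectralRadius * ∑ u, z u ^ 2 = ∑ u, ∑ v, (G.dist u v : ℝ) * z u * z v := by
      rw [Finset.mul_sum]
      refine Finset.sum_congr rfl fun u _ => ?_
      have h2 := congrFun hz u
      rw [distMatrix_mulVec, Pi.smul_apply, smul_eq_mul] at h2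
      rw [distSpectralRadius, sq, ← mul_assoc, ← h2, Finset.sum_mul]
      exact Finset.sum_congr rfl fun v _ => by ring
    rw [h1]
    refine Finset.sum_le_sum fun u _ => Finset.sum_le_sum fun v _ => ?_
    rw [mul_assoc, mul_assoc, ← abs_mul]
    exact mul_le_mul_of_nonneg_left (le_abs_self _) (Nat.cast_nonneg _)
  have hge := G.sum_dist_mul_le fun u => |z u|
  simp only [sq_abs] at hge
  have hx := G.distMatrix_isHermitian.mulVec_eq_of_dotProduct_mulVec_eq (x := fun u => |z u|) (by
    simp only [dotProduct, distMatrix_mulVec, Finset.mul_sum (Finset.univ), ← sq]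
    have := le_antisymm hge hle
    rw [distSpectralRadius, Finset.mul_sum] at this
    simp only [sq_abs]
    rw [← this]
    exact Finset.sum_congr rfl fun u _ => Finset.sum_congr rfl fun v _ => by ring)
  have hx' : ∀ u, ∑ v, (G.dist u v : ℝ) * |z v| = G.distSpectralRadius * |z u| := fun u => by
    rw [← distMatrix_mulVec (x := fun v => |z v|), hx]; rfl
  refine ⟨fun u => |z u|, fun u => ?_, hx'⟩
  -- A zero entry at `u` makes row `u` sum to zero; its off-diagonal distances are positive, so `z`
  -- would vanish.
  refine lt_of_le_of_ne (abs_nonneg _) fun h => hz0 ?_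
  have h0 := hx' u
  change 0 = |z u| at h
  rw [← h, mul_zero, Finset.sum_eq_zero_iff_of_nonneg fun v _ => by positivity] at h0
  ext v
  by_cases huv : v = u
  · rw [huv]; exact abs_eq_zero.1 h.symm
  · have h1 := h0 v (Finset.mem_univ v)
    have h2 : (G.dist u v : ℝ) ≠ 0 := by
      exact_mod_cast (hG.pos_dist_of_ne (Ne.symm huv)).ne'
    simpa [h2] using h1

/-- The Collatz–Wielandt upper bound for the distance spectral radius. -/
theorem Connected.distSpectralRadius_lt [Nontrivial V] (hG : G.Connected) {y : V → ℝ} {μ : ℝ}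
    (hy : ∀ u, 0 < y u) (hle : ∀ u, ∑ v, (G.dist u v : ℝ) * y v ≤ μ * y u)
    (hlt : ∃ u, ∑ v, (G.dist u v : ℝ) * y v < μ * y u) : G.distSpectralRadius < μ := by
  obtain ⟨x, hx, hxe⟩ := hG.exists_perronVector
  -- Pairing with the Perron vector turns the rowwise bound into a scalar one, by symmetry of the
  -- matrix.
  have h1 : ∑ u, x u * ∑ v, (G.dist u v : ℝ) * y v < ∑ u, x u * (μ * y u) := by
    obtain ⟨w, hw⟩ := hlt
    exact Finset.sum_lt_sum (fun u _ => mul_le_mul_of_nonneg_left (hle u) (hx u).le)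
      ⟨w, Finset.mem_univ w, mul_lt_mul_of_pos_left hw (hx w)⟩
  have h2 : ∑ u, x u * ∑ v, (G.dist u v : ℝ) * y v =
      ∑ u, G.distSpectralRadius * x u * y u := by
    simp only [← hxe, Finset.mul_sum, Finset.sum_mul]
    rw [Finset.sum_comm]
    refine Finset.sum_congr rfl fun u _ => Finset.sum_congr rfl fun v _ => ?_
    rw [dist_comm]; ring
  rw [h2] at h1
  have h3 : 0 < ∑ u, x u * y u :=
    Finset.sum_pos (fun u _ => mul_pos (hx u) (hy u)) Finset.univ_nonempty
  have h4 : G.distSpectralRadius * ∑ u, x u * y u < μ * ∑ u, x u * y u := by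
    simp only [Finset.mul_sum]
    convert h1 using 2 <;> ring
  exact lt_of_mul_lt_mul_right h4 h3.le

end SimpleGraph

/-! ### Distances and spectrum of `K_s ∨ (K_m + k K₁)`. -/

namespace SimpleGraph

section CliqueJoin

variable {s m k : ℕ}

@[simp] theorem cliqueJoin_adj_inl_inl {i j : Fin s} :
    (cliqueJoin s m k).Adj (.inl i) (.inl j) ↔ i ≠ j := by
  simp [cliqueJoin, join]

@[simp] theorem cliqueJoin_adj_inl_inr {i : Fin s} {b : Fin m ⊕ Fin k} :
    (cliqueJoin s m k).Adj (.inl i) (.inr b) := by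
  simp [cliqueJoin, join]

@[simp] theorem cliqueJoin_adj_inr_inl {i : Fin s} {b : Fin m ⊕ Fin k} :
    (cliqueJoin s m k).Adj (.inr b) (.inl i) := by
  simp [cliqueJoin, join]

@[simp] theorem cliqueJoin_adj_big_big {i j : Fin m} :
    (cliqueJoin s m k).Adj (.inr (.inl i)) (.inr (.inl j)) ↔ i ≠ j := by
  simp [cliqueJoin, join]

@[simp] theorem cliqueJoin_adj_big_single {i : Fin m} {j : Fin k} :
    ¬ (cliqueJoin s m k).Adj (.inr (.inl i)) (.inr (.inr j)) := by
  simp [cliqueJoin, join]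

@[simp] theorem cliqueJoin_adj_single_big {i : Fin k} {j : Fin m} :
    ¬ (cliqueJoin s m k).Adj (.inr (.inr i)) (.inr (.inl j)) := by
  simp [cliqueJoin, join]

@[simp] theorem cliqueJoin_adj_single_single {i j : Fin k} :
    ¬ (cliqueJoin s m k).Adj (.inr (.inr i)) (.inr (.inr j)) := by
  simp [cliqueJoin, join]

theorem cliqueJoin_connected (hs : 0 < s) : (cliqueJoin s m k).Connected := by
  refine (connected_iff_exists_forall_reachable _).2 ⟨.inl ⟨0, hs⟩, ?_⟩
  rintro (i | b)
  · by_cases h : (⟨0, hs⟩ : Fin s) = i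
    · rw [h]
    · exact (cliqueJoin_adj_inl_inl.2 h).reachable
  · exact cliqueJoin_adj_inl_inr.reachable

theorem cliqueJoin_dist_eq_two (hs : 0 < s) {a b : Fin s ⊕ (Fin m ⊕ Fin k)} (hab : a ≠ b)
    (h : ¬ (cliqueJoin s m k).Adj a b) : (cliqueJoin s m k).dist a b = 2 := by
  refine le_antisymm ?_ ((cliqueJoin_connected hs).one_lt_dist_of_ne_of_not_adj hab h)
  rcases a with i | a
  · rcases b with j | b
    · exact absurd (cliqueJoin_adj_inl_inl.2 fun h => hab (by rw [h])) h
    · exact absurd cliqueJoin_adj_inl_inr h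
  · rcases b with j | b
    · exact absurd cliqueJoin_adj_inr_inl h
    · exact dist_le (.cons (cliqueJoin_adj_inr_inl (i := ⟨0, hs⟩))
        (.cons cliqueJoin_adj_inl_inr .nil))

theorem cliqueJoin_dist_inl_inl {i j : Fin s} :
    (cliqueJoin s m k).dist (.inl i) (.inl j) = if i = j then 0 else 1 := by
  split_ifs with h
  · simp [h]
  · exact dist_eq_one_iff_adj.2 (cliqueJoin_adj_inl_inl.2 h)

theorem cliqueJoin_dist_inl_inr {i : Fin s} {b : Fin m ⊕ Fin k} :
    (cliqueJoin s m k).dist (.inl i) (.inr b) = 1 :=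
  dist_eq_one_iff_adj.2 cliqueJoin_adj_inl_inr

theorem cliqueJoin_dist_inr_inl {i : Fin s} {b : Fin m ⊕ Fin k} :
    (cliqueJoin s m k).dist (.inr b) (.inl i) = 1 :=
  dist_eq_one_iff_adj.2 cliqueJoin_adj_inr_inl

theorem cliqueJoin_dist_big_big {i j : Fin m} :
    (cliqueJoin s m k).dist (.inr (.inl i)) (.inr (.inl j)) = if i = j then 0 else 1 := by
  split_ifs with h
  · simp [h]
  · exact dist_eq_one_iff_adj.2 (cliqueJoin_adj_big_big.2 h)

theorem cliqueJoin_dist_big_single (hs : 0 < s) {i : Fin m} {j : Fin k} :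
    (cliqueJoin s m k).dist (.inr (.inl i)) (.inr (.inr j)) = 2 :=
  cliqueJoin_dist_eq_two hs (by simp) cliqueJoin_adj_big_single

theorem cliqueJoin_dist_single_big (hs : 0 < s) {i : Fin k} {j : Fin m} :
    (cliqueJoin s m k).dist (.inr (.inr i)) (.inr (.inl j)) = 2 :=
  cliqueJoin_dist_eq_two hs (by simp) cliqueJoin_adj_single_big

theorem cliqueJoin_dist_single_single (hs : 0 < s) {i j : Fin k} :
    (cliqueJoin s m k).dist (.inr (.inr i)) (.inr (.inr j)) = if i = j then 0 else 2 := by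
  split_ifs with h
  · simp [h]
  · exact cliqueJoin_dist_eq_two hs (by simpa using h) cliqueJoin_adj_single_single

theorem _root_.Fintype.sum_ite_eq_zero_mul {ι : Type*} [Fintype ι] [DecidableEq ι] (c : ℝ)
    (x : ι → ℝ) (i : ι) :
    ∑ j, (if i = j then 0 else c) * x j = c * (∑ j, x j - x i) := by
  have : ∀ j, (if i = j then 0 else c) * x j = c * x j - if i = j then c * x j else 0 := by
    intro j; split_ifs <;> ring
  simp only [this, Finset.sum_sub_distrib, Finset.sum_ite_eq, Finset.mem_univ, if_true, mul_sub,
    Finset.mul_sum]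

variable (x : Fin s ⊕ (Fin m ⊕ Fin k) → ℝ)

theorem cliqueJoin_sum_dist_inl (i : Fin s) :
    ∑ b, ((cliqueJoin s m k).dist (.inl i) b : ℝ) * x b = ∑ b, x b - x (.inl i) := by
  have := Fintype.sum_ite_eq_zero_mul 1 (fun j => x (.inl j)) i
  simp only [Fintype.sum_sum_type, cliqueJoin_dist_inl_inl, cliqueJoin_dist_inl_inr] at this ⊢
  push_cast
  rw [this]
  simp only [one_mul]
  ring

theorem cliqueJoin_sum_dist_big (hs : 0 < s) (i : Fin m) :
    ∑ b, ((cliqueJoin s m k).dist (.inr (.inl i)) b : ℝ) * x b =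
      ∑ b, x b + ∑ j, x (.inr (.inr j)) - x (.inr (.inl i)) := by
  have := Fintype.sum_ite_eq_zero_mul 1 (fun j => x (.inr (.inl j))) i
  simp only [Fintype.sum_sum_type, cliqueJoin_dist_inr_inl, cliqueJoin_dist_big_big,
    cliqueJoin_dist_big_single hs] at this ⊢
  push_cast
  simp only [this, ← Finset.mul_sum]
  simp only [one_mul]
  ring

theorem cliqueJoin_sum_dist_single (hs : 0 < s) (j : Fin k) :
    ∑ b, ((cliqueJoin s m k).dist (.inr (.inr j)) b : ℝ) * x b =
      ∑ b, x b + ∑ i, x (.inr (.inl i)) + ∑ j, x (.inr (.inr j)) - 2 * x (.inr (.inr j)) := by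
  have := Fintype.sum_ite_eq_zero_mul 2 (fun j => x (.inr (.inr j))) j
  simp only [Fintype.sum_sum_type, cliqueJoin_dist_inr_inl, cliqueJoin_dist_single_big hs,
    cliqueJoin_dist_single_single hs] at this ⊢
  push_cast
  simp only [this, ← Finset.mul_sum]
  simp only [one_mul]
  ring

theorem cliqueJoin_nontrivial (hs : 0 < s) (hk : 0 < k) :
    Nontrivial (Fin s ⊕ (Fin m ⊕ Fin k)) :=
  ⟨.inl ⟨0, hs⟩, .inr (.inr ⟨0, hk⟩), by simp⟩

/-- An upper bound for the distance spectral radius of `K_s ∨ (K_m + k K₁)`, obtained from the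
test vector with value `a` on the `k` isolated vertices and `1` elsewhere. -/
theorem cliqueJoin_distSpectralRadius_lt (hs : 0 < s) (hk : 0 < k) {a μ : ℝ} (ha : 0 < a)
    (hbig : s + m - 1 + 2 * k * a ≤ μ) (hsingle : s + 2 * m + 2 * (k - 1) * a ≤ μ * a) :
    (cliqueJoin s m k).distSpectralRadius < μ := by
  have := cliqueJoin_nontrivial (m := m) hs hk
  have hka : 0 < (k : ℝ) * a := by positivity
  refine (cliqueJoin_connected hs).distSpectralRadius_lt
    (y := Sum.elim (fun _ => 1) (Sum.elim (fun _ => 1) (fun _ => a))) ?_ ?_ ⟨.inl ⟨0, hs⟩, ?_⟩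
  · rintro (i | i | i) <;> simp [ha]
  · rintro (i | i | i)
    · rw [cliqueJoin_sum_dist_inl]
      simp
      linarith
    · rw [cliqueJoin_sum_dist_big _ hs]
      simp
      linarith
    · rw [cliqueJoin_sum_dist_single _ hs]
      simp
      linarith
  · rw [cliqueJoin_sum_dist_inl]
    simp
    linarith

/-- The Perron vector of `K_s ∨ (K_m + k K₁)` takes a single value `q` on the vertices of `K_m`
and a single value `p` on the isolated vertices, and `p < 2 q`. -/
theorem exists_cliqueJoin_perronVector (hs : 0 < s) (hk : 0 < k) :
    ∃ (x : Fin s ⊕ (Fin m ⊕ Fin k) → ℝ) (p q : ℝ), (∀ a, 0 < x a) ∧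
      (∀ i, x (.inr (.inl i)) = q) ∧ (∀ j, x (.inr (.inr j)) = p) ∧ 0 < p ∧ 0 < q ∧ p < 2 * q ∧
      ∀ a, ∑ b, ((cliqueJoin s m k).dist a b : ℝ) * x b =
        (cliqueJoin s m k).distSpectralRadius * x a := by
  have := cliqueJoin_nontrivial (m := m) hs hk
  obtain ⟨x, hx, hxe⟩ := (cliqueJoin_connected (m := m) (k := k) hs).exists_perronVector
  set μ := (cliqueJoin s m k).distSpectralRadius
  set P := ∑ j, x (.inr (.inr j)) with hP
  set Q := ∑ i, x (.inr (.inl i)) with hQ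
  set T := ∑ b, x b with hT
  have hT' : T = ∑ i, x (.inl i) + (Q + P) := by simp [hT, hP, hQ, Fintype.sum_sum_type]
  have hC : 0 < ∑ i, x (.inl i) :=
    Finset.sum_pos (fun _ _ => hx _) ⟨⟨0, hs⟩, Finset.mem_univ _⟩
  have hP0 : 0 < P := Finset.sum_pos (fun _ _ => hx _) ⟨⟨0, hk⟩, Finset.mem_univ _⟩
  have hQ0 : 0 ≤ Q := Finset.sum_nonneg fun _ _ => (hx _).le
  have hμ : 0 ≤ μ := by
    have h := hxe (.inl ⟨0, hs⟩)
    by_contra hneg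
    have h1 := mul_neg_of_neg_of_pos (not_le.1 hneg) (hx (.inl ⟨0, hs⟩))
    rw [← h] at h1
    exact absurd h1 (not_lt.2 (Finset.sum_nonneg fun b _ => mul_nonneg (by positivity) (hx b).le))
  have hμ1 : 0 < μ + 1 := by linarith
  have hμ2 : 0 < μ + 2 := by linarith
  refine ⟨x, (T + Q + P) / (μ + 2), (T + P) / (μ + 1), hx, fun i => ?_, fun j => ?_, ?_, ?_, ?_,
    hxe⟩
  · have h := hxe (.inr (.inl i))
    rw [cliqueJoin_sum_dist_big _ hs] at h
    rw [eq_div_iff hμ1.ne']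
    linarith
  · have h := hxe (.inr (.inr j))
    rw [cliqueJoin_sum_dist_single _ hs] at h
    rw [eq_div_iff hμ2.ne']
    linarith
  · apply div_pos <;> linarith
  · apply div_pos <;> linarith
  -- The total `T` exceeds its part `Q`, so `Q < T + P`.
  · calc (T + Q + P) / (μ + 2) < 2 * (T + P) / (μ + 2) := by gcongr; linarith
      _ ≤ 2 * (T + P) / (μ + 1) := by
        apply div_le_div_of_nonneg_left <;> linarith
      _ = 2 * ((T + P) / (μ + 1)) := by ring

end CliqueJoin

end SimpleGraph

/-! ### Entrywise comparison with the extremal graph. -/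

namespace SimpleGraph

variable {V : Type*} {G : SimpleGraph V}

theorem Connected.two_le_dist (hG : G.Connected) {u v : V} (huv : u ≠ v) (h : ¬ G.Adj u v) :
    (2 : ℝ) ≤ G.dist u v := by
  exact_mod_cast hG.one_lt_dist_of_ne_of_not_adj huv h

theorem Connected.one_le_dist (hG : G.Connected) {u v : V} (huv : u ≠ v) :
    (1 : ℝ) ≤ G.dist u v := by
  exact_mod_cast hG.pos_dist_of_ne huv

variable [Fintype V] [DecidableEq V] {s m k : ℕ}

/-- Let the vertices of `G` be split into `s` arbitrary vertices, `m` vertices coloured by `g`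
and `k` vertices of distinct colours `some j`, such that two of the `m` vertices have colour
`none` and no edge joins vertices of different colours. Then `G` has distance spectral radius
greater than that of `K_s ∨ (K_m + k K₁)`, unless they are isomorphic. -/
theorem Connected.iso_cliqueJoin_of_coloring (hG : G.Connected) (hs : 0 < s) (hk : 0 < k)
    (e : Fin s ⊕ (Fin m ⊕ Fin k) ≃ V) (g : Fin m → Option (Fin k)) {w₁ w₂ : Fin m}
    (hw : w₁ ≠ w₂) (hw₁ : g w₁ = none) (hw₂ : g w₂ = none)
    (hbb : ∀ i i', g i ≠ g i' → ¬ G.Adj (e (.inr (.inl i))) (e (.inr (.inl i'))))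
    (hbs : ∀ i j, g i ≠ some j → ¬ G.Adj (e (.inr (.inl i))) (e (.inr (.inr j))))
    (hss : ∀ j j', ¬ G.Adj (e (.inr (.inr j))) (e (.inr (.inr j'))))
    (hle : G.distSpectralRadius ≤ (cliqueJoin s m k).distSpectralRadius) :
    Nonempty (G ≃g cliqueJoin s m k) := by
  obtain ⟨x, p, q, hx, hxq, hxp, hp, hq, hpq, hxe⟩ := exists_cliqueJoin_perronVector (m := m) hs hk
  set Δ : Fin s ⊕ (Fin m ⊕ Fin k) → Fin s ⊕ (Fin m ⊕ Fin k) → ℝ :=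
    fun a b => G.dist (e a) (e b) - (cliqueJoin s m k).dist a b with hΔ
  have hΔ0 : ∀ a, Δ a a = 0 := fun a => by simp [hΔ]
  have hΔsymm : ∀ a b, Δ a b = Δ b a := fun a b => by
    simp only [hΔ]; rw [dist_comm, dist_comm (u := a)]
  have hΔadj : ∀ a b, (cliqueJoin s m k).Adj a b → 0 ≤ Δ a b := fun a b h => by
    simp only [hΔ, dist_eq_one_iff_adj.2 h]
    have := hG.one_le_dist (e.injective.ne h.ne)
    push_cast
    linarith
  have hΔnonadj : ∀ a b, ¬ G.Adj (e a) (e b) → 0 ≤ Δ a b := fun a b h => by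
    by_cases hab : a = b
    · rw [hab, hΔ0]
    · by_cases h' : (cliqueJoin s m k).Adj a b
      · exact hΔadj a b h'
      · simp only [hΔ, cliqueJoin_dist_eq_two hs hab h']
        have := hG.two_le_dist (e.injective.ne hab) h
        push_cast
        linarith
  have hΔinl : ∀ i b, 0 ≤ Δ (.inl i) b := by
    rintro i (j | b)
    · by_cases h : i = j
      · rw [h, hΔ0]
      · exact hΔadj _ _ (cliqueJoin_adj_inl_inl.2 h)
    · exact hΔadj _ _ cliqueJoin_adj_inl_inr
  have hΔss : ∀ j j', 0 ≤ Δ (.inr (.inr j)) (.inr (.inr j')) := fun j j' => hΔnonadj _ _ (hss j j')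
  have hΔbb : ∀ i i', 0 ≤ Δ (.inr (.inl i)) (.inr (.inl i')) := fun i i' => by
    by_cases h : i = i'
    · rw [h, hΔ0]
    · exact hΔadj _ _ (cliqueJoin_adj_big_big.2 h)
  have hsum : ∑ a, ∑ b, Δ a b * x a * x b ≤ 0 := by
    have h1 := G.sum_dist_mul_le fun v => x (e.symm v)
    simp only [← e.sum_comp, Equiv.symm_apply_apply] at h1
    have h2 : ∑ a, ∑ b, ((cliqueJoin s m k).dist a b : ℝ) * x a * x b =
        (cliqueJoin s m k).distSpectralRadius * ∑ a, x a ^ 2 := by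
      rw [Finset.mul_sum]
      refine Finset.sum_congr rfl fun a _ => ?_
      rw [sq, ← mul_assoc, ← hxe a, Finset.sum_mul]
      exact Finset.sum_congr rfl fun b _ => by ring
    have h3 := mul_le_mul_of_nonneg_right hle
      (Finset.sum_nonneg fun a (_ : a ∈ Finset.univ) => sq_nonneg (x a))
    simp only [hΔ, sub_mul, Finset.sum_sub_distrib]
    linarith
  have hnone : ∀ i, g i = none := by
    by_contra! hne
    obtain ⟨i₀, hi₀⟩ := hne
    set N : ℝ := ∑ i, if g i = none then 0 else 1 with hN
    have hNpos : 0 < N :=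
      Finset.sum_pos' (fun i _ => by split_ifs <;> norm_num) ⟨i₀, Finset.mem_univ _, by simp [hi₀]⟩
    have hbbsum : 4 * q ^ 2 * N ≤
        ∑ i, ∑ i', Δ (.inr (.inl i)) (.inr (.inl i')) * q * q := by
      -- The left side marks the pairs formed by `w₁` or `w₂` and a vertex of colour other than
      -- `none`. Each of the `N` such vertices occurs in four ordered pairs, whence `4 * q ^ 2 * N`.
      have key : ∀ i i', ((if g i = none then 0 else 1) * ((if i' = w₁ then 1 else 0) +
          (if i' = w₂ then 1 else 0)) + (if g i' = none then 0 else 1) *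
          ((if i = w₁ then 1 else 0) + (if i = w₂ then 1 else 0)) : ℝ) ≤
          Δ (.inr (.inl i)) (.inr (.inl i')) := by
        intro i i'
        have h0 := hΔbb i i'
        have h1 : g i ≠ g i' → 1 ≤ Δ (.inr (.inl i)) (.inr (.inl i')) := fun h => by
          have hii : i ≠ i' := fun h' => h (by rw [h'])
          have := hG.two_le_dist (e.injective.ne (by simpa using hii)) (hbb i i' h)
          simp only [hΔ, cliqueJoin_dist_big_big, if_neg hii]
          push_cast
          linarith
        by_cases hi : g i = none
        · by_cases hi' : g i' = none
          · simpa [hi, hi'] using h0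
          · have h1 := h1 (by rw [hi]; exact Ne.symm hi')
            by_cases h₁ : i = w₁
            · simpa [hi, hi', h₁, hw, hw₁] using h1
            · by_cases h₂ : i = w₂
              · simpa [hi, hi', h₂, hw.symm, hw₂] using h1
              · simpa [hi, hi', h₁, h₂] using h0
        · by_cases hi' : g i' = none
          · have h1 := h1 (by rw [hi']; exact hi)
            by_cases h₁ : i' = w₁
            · simpa [hi, hi', h₁, hw, hw₁] using h1
            · by_cases h₂ : i' = w₂
              · simpa [hi, hi', h₂, hw.symm, hw₂] using h1
              · simpa [hi, hi', h₁, h₂] using h0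
          · have a1 : i ≠ w₁ := fun h => hi (h ▸ hw₁)
            have a2 : i ≠ w₂ := fun h => hi (h ▸ hw₂)
            have a3 : i' ≠ w₁ := fun h => hi' (h ▸ hw₁)
            have a4 : i' ≠ w₂ := fun h => hi' (h ▸ hw₂)
            simpa [a1, a2, a3, a4] using h0
      have hsum2 := Finset.sum_le_sum fun i (_ : i ∈ Finset.univ) =>
        Finset.sum_le_sum fun i' (_ : i' ∈ Finset.univ) =>
          mul_le_mul_of_nonneg_right (mul_le_mul_of_nonneg_right (key i i') hq.le) hq.le
      refine le_trans (le_of_eq ?_) hsum2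
      simp only [add_mul, mul_assoc, Finset.sum_add_distrib, ← Finset.sum_mul, ← Finset.mul_sum,
        ← hN, mul_add, Finset.sum_ite_eq', Finset.mem_univ, if_true]
      ring
    have hbssum : -(p * q * N) ≤ ∑ i, ∑ j, Δ (.inr (.inl i)) (.inr (.inr j)) * q * p := by
      have key : ∀ i j, -(if g i = some j then 1 else 0 : ℝ) ≤
          Δ (.inr (.inl i)) (.inr (.inr j)) := by
        intro i j
        split_ifs with h
        · have := hG.one_le_dist (u := e (.inr (.inl i))) (v := e (.inr (.inr j)))
            (e.injective.ne (by simp))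
          simp only [hΔ, cliqueJoin_dist_big_single hs]
          push_cast
          linarith
        · simpa using hΔnonadj _ _ (hbs i j h)
      have hsum2 := Finset.sum_le_sum fun i (_ : i ∈ Finset.univ) =>
        Finset.sum_le_sum fun j (_ : j ∈ Finset.univ) =>
          mul_le_mul_of_nonneg_right (mul_le_mul_of_nonneg_right (key i j) hq.le) hp.le
      refine le_trans (le_of_eq ?_) hsum2
      have h1 : ∀ i, ∑ j, (if g i = some j then 1 else 0 : ℝ) = if g i = none then 0 else 1 := by
        intro i
        rcases g i with _ | j <;> simp
      simp only [← Finset.sum_mul, Finset.sum_neg_distrib, h1, ← hN]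
      ring
    have hsbsum : -(p * q * N) ≤ ∑ j, ∑ i, Δ (.inr (.inr j)) (.inr (.inl i)) * p * q := by
      rw [Finset.sum_comm]
      refine hbssum.trans (le_of_eq ?_)
      refine Finset.sum_congr rfl fun i _ => Finset.sum_congr rfl fun j _ => ?_
      rw [hΔsymm]; ring
    have hsssum : 0 ≤ ∑ j, ∑ j', Δ (.inr (.inr j)) (.inr (.inr j')) * p * p :=
      Finset.sum_nonneg fun j _ => Finset.sum_nonneg fun j' _ =>
        mul_nonneg (mul_nonneg (hΔss j j') hp.le) hp.le
    have h1 : 0 ≤ ∑ i, ∑ b, Δ (.inl i) b * x (.inl i) * x b :=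
      Finset.sum_nonneg fun i _ => Finset.sum_nonneg fun b _ =>
        mul_nonneg (mul_nonneg (hΔinl i b) (hx _).le) (hx _).le
    have h2 : 0 ≤ ∑ b, ∑ i, Δ (.inr b) (.inl i) * x (.inr b) * x (.inl i) :=
      Finset.sum_nonneg fun b _ => Finset.sum_nonneg fun i _ =>
        mul_nonneg (mul_nonneg (hΔsymm _ _ ▸ hΔinl i _) (hx _).le) (hx _).le
    rw [Fintype.sum_sum_type] at hsum
    simp only [Fintype.sum_sum_type (fun b => Δ (Sum.inr _) b * _ * x b),
      Finset.sum_add_distrib] at hsum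
    rw [Fintype.sum_sum_type (fun b => ∑ c, Δ (.inr b) (.inr c) * _ * _)] at hsum
    simp only [Fintype.sum_sum_type (fun b => Δ (.inr _) (.inr b) * _ * _), hxp, hxq,
      Finset.sum_add_distrib] at hsum
    -- Net change: gain `4 * q ^ 2 * N` against a loss of at most `2 * p * q * N`.
    have h3 : 0 < N * (2 * q * (2 * q - p)) := by
      have : 0 < 2 * q - p := by linarith
      positivity
    linarith
  have hΔnonneg : ∀ a b, 0 ≤ Δ a b := by
    rintro (i | i | i) b
    · exact hΔinl i b
    · rcases b with j | j | j
      · rw [hΔsymm]; exact hΔinl j _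
      · exact hΔbb i j
      · exact hΔnonadj _ _ (hbs i j (by simp [hnone i]))
    · rcases b with j | j | j
      · rw [hΔsymm]; exact hΔinl j _
      · rw [hΔsymm]; exact hΔnonadj _ _ (hbs j i (by simp [hnone j]))
      · exact hΔss i j
  have hF : ∀ a b, 0 ≤ Δ a b * x a * x b := fun a b =>
    mul_nonneg (mul_nonneg (hΔnonneg a b) (hx _).le) (hx _).le
  have hΔzero : ∀ a b, Δ a b = 0 := by
    intro a b
    have h0 := le_antisymm hsum
      (Finset.sum_nonneg fun a _ => Finset.sum_nonneg fun b _ => hF a b)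
    have h1 := (Finset.sum_eq_zero_iff_of_nonneg fun a _ =>
      Finset.sum_nonneg fun b _ => hF a b).1 h0 a (Finset.mem_univ a)
    have h2 := (Finset.sum_eq_zero_iff_of_nonneg fun b _ => hF a b).1 h1 b (Finset.mem_univ b)
    simpa [(hx a).ne', (hx b).ne'] using h2
  refine ⟨(⟨e, fun {a b} => ?_⟩ : cliqueJoin s m k ≃g G).symm⟩
  rw [← dist_eq_one_iff_adj, ← dist_eq_one_iff_adj]
  have h := hΔzero a b
  simp only [hΔ, sub_eq_zero, Nat.cast_inj] at h
  rw [h]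

end SimpleGraph

/-! ### Components, colourings and toughness. -/

namespace SimpleGraph

variable {V : Type*} {G : SimpleGraph V}

theorem Walk.map_eq_of_adj {ι : Type*} {F : V → ι} (hF : ∀ u v, G.Adj u v → F u = F v)
    {u v : V} (p : G.Walk u v) : F u = F v := by
  induction p with
  | nil => rfl
  | cons h _ ih => exact (hF _ _ h).trans ih

variable [Fintype V]

theorem isCutSet_iff_one_lt_numCompDelete {S : Finset V} :
    G.IsCutSet S ↔ 1 < G.numCompDelete S := by
  rw [IsCutSet, numCompDelete, Finite.one_lt_card_iff_nontrivial, ← not_subsingleton_iff_nontrivial,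
    not_iff_not]
  refine ⟨fun h => h.subsingleton_connectedComponent, fun h u v => ?_⟩
  exact ConnectedComponent.exact (Subsingleton.elim _ _)

theorem card_add_numCompDelete_le (G : SimpleGraph V) (S : Finset V) :
    S.card + G.numCompDelete S ≤ Fintype.card V := by
  classical
  have h1 : G.numCompDelete S ≤ Nat.card ((S : Set V)ᶜ : Set V) :=
    Nat.card_le_card_of_surjective _ Quot.mk_surjective
  have h2 : Nat.card ((S : Set V)ᶜ : Set V) = Fintype.card V - S.card := by
    rw [Nat.card_eq_fintype_card, ← Finset.card_compl, ← Set.toFinset_card]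
    congr 1
    ext; simp
  have := S.card_le_univ
  omega

/-- Embed the colours into the components and invert. Surplus components, and the vertices of `S`,
receive a default colour. -/
theorem exists_coloring_of_le_numCompDelete {ι : Type*} [Fintype ι] [Nonempty ι] {S : Finset V}
    (h : Fintype.card ι ≤ G.numCompDelete S) :
    ∃ F : V → ι, (∀ u ∉ S, ∀ v ∉ S, G.Adj u v → F u = F v) ∧ ∀ i, ∃ u ∉ S, F u = i := by
  classical
  have := Fintype.ofFinite (G.induce ((S : Set V)ᶜ)).ConnectedComponent
  rw [numCompDelete, Nat.card_eq_fintype_card] at h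
  obtain ⟨f⟩ := Function.Embedding.nonempty_of_card_le h
  refine ⟨fun v => if hv : v ∈ S then Classical.arbitrary ι else
    Function.invFun f ((G.induce ((S : Set V)ᶜ)).connectedComponentMk ⟨v, by simpa using hv⟩),
    ?_, ?_⟩
  · intro u hu v hv huv
    simp only [hu, hv, dif_neg, not_false_eq_true]
    congr 1
    exact ConnectedComponent.sound (Adj.reachable (by simpa using huv))
  · intro i
    obtain ⟨⟨u, hu⟩, hui⟩ := Quot.exists_rep (f i)
    have hu' : u ∉ S := by simpa using hu
    refine ⟨u, hu', ?_⟩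
    simp only [hu', dif_neg, not_false_eq_true]
    rw [← Function.leftInverse_invFun f.injective i]
    exact congrArg _ hui

theorem card_le_numCompDelete_of_coloring {ι : Type*} [Fintype ι] {S : Finset V} {F : V → ι}
    (hF : ∀ u ∉ S, ∀ v ∉ S, G.Adj u v → F u = F v) (hsurj : ∀ i, ∃ u ∉ S, F u = i) :
    Fintype.card ι ≤ G.numCompDelete S := by
  rw [numCompDelete, ← Nat.card_eq_fintype_card]
  refine Nat.card_le_card_of_surjective
    (ConnectedComponent.lift (fun v => F v.1) fun v w p _ => ?_) fun i => ?_
  · refine p.map_eq_of_adj (F := fun v => F v.1) fun u v huv => ?_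
    exact hF _ u.2 _ v.2 (by simpa using huv)
  · obtain ⟨u, hu, hui⟩ := hsurj i
    exact ⟨connectedComponentMk _ ⟨u, by simpa using hu⟩, hui⟩

theorem Connected.nonempty_of_isCutSet (hG : G.Connected) {S : Finset V} (hS : G.IsCutSet S) :
    S.Nonempty := by
  rw [isCutSet_iff_one_lt_numCompDelete] at hS
  by_contra h
  rw [Finset.not_nonempty_iff_eq_empty] at h
  obtain ⟨F, hF, hsurj⟩ := exists_coloring_of_le_numCompDelete (ι := Fin 2) (by simpa [Nat.succ_le_iff] using hS)
  obtain ⟨u, _, hu⟩ := hsurj 0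
  obtain ⟨v, _, hv⟩ := hsurj 1
  obtain ⟨p⟩ := hG.preconnected u v
  have := p.map_eq_of_adj fun a b hab => hF a (by simp [h]) b (by simp [h]) hab
  simp [hu, hv] at this

/-- Enlarge `S` while sparing one vertex of each colour of a 2-colouring; the colouring still
certifies disconnection. -/
theorem IsCutSet.exists_superset_card_eq {S : Finset V} (hS : G.IsCutSet S) {r : ℕ}
    (hr : S.card ≤ r) (hrn : r + 2 ≤ Fintype.card V) :
    ∃ S' : Finset V, S'.card = r ∧ G.IsCutSet S' := by
  classical
  simp only [isCutSet_iff_one_lt_numCompDelete] at hS ⊢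
  obtain ⟨F, hF, hsurj⟩ := exists_coloring_of_le_numCompDelete (ι := Fin 2) (by simpa [Nat.succ_le_iff] using hS)
  obtain ⟨u, huS, hu⟩ := hsurj 0
  obtain ⟨v, hvS, hv⟩ := hsurj 1
  have huv : u ≠ v := by rintro rfl; simp [hu] at hv
  obtain ⟨S', hSS', hS'uv, hcard⟩ := Finset.exists_subsuperset_card_eq (s := S) (t := {u, v}ᶜ)
    (n := r) (fun w hw => by
      simp only [Finset.mem_compl, Finset.mem_insert, Finset.mem_singleton, not_or]
      exact ⟨fun h => huS (h ▸ hw), fun h => hvS (h ▸ hw)⟩) hr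
    (by rw [Finset.card_compl, Finset.card_pair huv]; omega)
  refine ⟨S', hcard, ?_⟩
  have := card_le_numCompDelete_of_coloring (S := S') (F := F)
    (fun a ha b hb => hF a (fun h => ha (hSS' h)) b (fun h => hb (hSS' h))) (fun i => ?_)
  · simpa [Nat.succ_le_iff] using this
  · fin_cases i
    · exact ⟨u, fun h => by simpa using hS'uv h, hu⟩
    · exact ⟨v, fun h => by simpa using hS'uv h, hv⟩

theorem not_isTough_iff {t : ℝ} :
    ¬ G.IsTough t ↔ ∃ S, 1 < G.numCompDelete S ∧ (S.card : ℝ) < t * G.numCompDelete S := by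
  simp only [IsTough, toughness, le_iInf₂_iff, EReal.coe_le_coe_iff, not_forall, not_le,
    isCutSet_iff_one_lt_numCompDelete, exists_prop]
  refine exists_congr fun S => and_congr_right fun h => ?_
  rw [div_lt_iff₀ (by exact_mod_cast (zero_lt_one.trans h))]

theorem not_isTough_of_iso_cliqueJoin {s m k : ℕ} (hm : 0 < m) (hk : 0 < k) {t : ℝ} (ht : 0 < t)
    (hst : (s : ℝ) < t * (k + 1)) (φ : G ≃g cliqueJoin s m k) : ¬ G.IsTough t := by
  classical
  rw [not_isTough_iff]
  set S : Finset V := (Finset.univ : Finset (Fin s)).map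
    ⟨fun i => φ.symm (.inl i), φ.symm.injective.comp Sum.inl_injective⟩ with hS
  have hmem : ∀ i, φ.symm (.inl i) ∈ S := fun i => by simp [hS]
  have hnot : ∀ b, φ.symm (.inr b) ∉ S := fun b => by simp [hS]
  have hinr : ∀ u ∉ S, ∃ b, φ u = .inr b := by
    intro u hu
    rcases h : φ u with i | b
    · exact absurd (by rw [← h, φ.symm_apply_apply] : φ.symm (.inl i) = u) fun h' => hu (h' ▸ hmem i)
    · exact ⟨b, rfl⟩
  have hcard : S.card = s := by simp [hS]
  have hcomp : k + 1 ≤ G.numCompDelete S := by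
    have := card_le_numCompDelete_of_coloring (G := G) (S := S)
      (F := fun u => (Sum.elim (fun _ => none) (Sum.elim (fun _ => none) some) (φ u) :
        Option (Fin k))) ?_ ?_
    · simpa using this
    · intro u hu v hv huv
      rw [← φ.map_adj_iff] at huv
      obtain ⟨b, hb⟩ := hinr u hu
      obtain ⟨b', hb'⟩ := hinr v hv
      simp only [hb, hb'] at huv ⊢
      rcases b with i | i <;> rcases b' with j | j
      · rfl
      · exact absurd huv cliqueJoin_adj_big_single
      · exact absurd huv cliqueJoin_adj_single_big
      · exact absurd huv cliqueJoin_adj_single_single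
    · rintro (_ | j)
      · exact ⟨φ.symm (.inr (.inl ⟨0, hm⟩)), hnot _, by simp⟩
      · exact ⟨φ.symm (.inr (.inr j)), hnot _, by simp⟩
  refine ⟨S, by omega, ?_⟩
  rw [hcard]
  refine hst.trans_le (mul_le_mul_of_nonneg_left ?_ ht.le)
  exact_mod_cast hcomp

variable [DecidableEq V]

/-- If deleting the `s` vertices of `S` leaves at least `k + 1` components, then `G` has distance
spectral radius greater than that of `K_s ∨ (K_m + k K₁)`, unless they are isomorphic. -/
theorem Connected.iso_cliqueJoin_of_le_numCompDelete (hG : G.Connected) {s m k : ℕ} (hs : 0 < s)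
    (hm : 1 < m) (hk : 0 < k) (hn : Fintype.card V = s + m + k) {S : Finset V} (hS : S.card = s)
    (hc : k + 1 ≤ G.numCompDelete S)
    (hle : G.distSpectralRadius ≤ (cliqueJoin s m k).distSpectralRadius) :
    Nonempty (G ≃g cliqueJoin s m k) := by
  obtain ⟨F₀, hF₀, hsurj₀⟩ :=
    exists_coloring_of_le_numCompDelete (ι := Option (Fin k)) (by simpa using hc)
  have hScard : Sᶜ.card = m + k := by rw [Finset.card_compl]; omega
  -- Since `m > 1`, there are more than `k + 1` vertices outside `S`, so two share a colour. The
  -- swap `σ` renames that colour `none`; each other colour then gets a representative `r j`, and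
  -- the remaining `m` vertices form `B`.
  obtain ⟨u₁, hu₁, u₂, hu₂, hu, hFu⟩ := Finset.exists_ne_map_eq_of_card_lt_of_maps_to
    (s := Sᶜ) (t := (Finset.univ : Finset (Option (Fin k)))) (f := F₀)
    (by simp [hScard]; omega) (fun _ _ => Finset.mem_coe.2 (Finset.mem_univ _))
  rw [Finset.mem_compl] at hu₁ hu₂
  let σ := Equiv.swap (F₀ u₁) none
  let F : V → Option (Fin k) := fun v => σ (F₀ v)
  have hF : ∀ u ∉ S, ∀ v ∉ S, G.Adj u v → F u = F v := fun u hu v hv h =>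
    congrArg σ (hF₀ u hu v hv h)
  have hsurj : ∀ j : Fin k, ∃ u ∉ S, F u = some j := fun j => by
    obtain ⟨u, hu, h⟩ := hsurj₀ (σ.symm (some j))
    exact ⟨u, hu, by simp [F, h]⟩
  have hF₁ : F u₁ = none := by simp [F, σ]
  have hF₂ : F u₂ = none := by simp [F, σ, ← hFu]
  choose r hrS hr using hsurj
  have hrinj : Function.Injective r := fun i j hij => by
    have := hr i
    rw [hij, hr j] at this
    exact (Option.some_injective _ this).symm
  set B : Finset V := (S ∪ Finset.univ.image r)ᶜ with hB
  have hmemB : ∀ v, v ∈ B ↔ v ∉ S ∧ ∀ j, r j ≠ v := fun v => by simp [hB]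
  have hBcard : B.card = m := by
    rw [hB, Finset.card_compl, Finset.card_union_of_disjoint, Finset.card_image_of_injective _ hrinj,
      Finset.card_univ, Fintype.card_fin]
    · omega
    · rw [Finset.disjoint_right]
      intro v hv
      obtain ⟨j, -, rfl⟩ := Finset.mem_image.1 hv
      exact hrS j
  let eS := (S.equivFinOfCardEq hS).symm
  let eB := (B.equivFinOfCardEq hBcard).symm
  let f : Fin s ⊕ (Fin m ⊕ Fin k) → V :=
    Sum.elim (fun i => (eS i).1) (Sum.elim (fun i => (eB i).1) r)
  have hBS : ∀ i, (eB i).1 ∉ S := fun i => ((hmemB _).1 (eB i).2).1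
  have hBr : ∀ i j, r j ≠ (eB i).1 := fun i => ((hmemB _).1 (eB i).2).2
  have hf : Function.Injective f := by
    rintro (a | a | a) (b | b | b) h <;> simp only [f, Sum.elim_inl, Sum.elim_inr] at h
    · rw [eS.injective (Subtype.ext h)]
    · exact absurd (h ▸ (eS a).2) (hBS b)
    · exact absurd (h ▸ (eS a).2) (hrS b)
    · exact absurd (h ▸ (eS b).2) (hBS a)
    · rw [eB.injective (Subtype.ext h)]
    · exact absurd h.symm (hBr a b)
    · exact absurd (h ▸ (eS b).2) (hrS a)
    · exact absurd h (hBr b a)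
    · rw [hrinj h]
  have hbij : Function.Bijective f :=
    (Fintype.bijective_iff_injective_and_card f).2 ⟨hf, by simp [hn, add_assoc]⟩
  have hu₁B : u₁ ∈ B := (hmemB _).2 ⟨hu₁, fun j h => by simpa [h, hF₁] using hr j⟩
  have hu₂B : u₂ ∈ B := (hmemB _).2 ⟨hu₂, fun j h => by simpa [h, hF₂] using hr j⟩
  refine hG.iso_cliqueJoin_of_coloring hs hk (Equiv.ofBijective f hbij) (fun i => F (eB i).1)
    (w₁ := eB.symm ⟨u₁, hu₁B⟩) (w₂ := eB.symm ⟨u₂, hu₂B⟩) ?_ ?_ ?_ ?_ ?_ ?_ hle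
  · simpa using hu
  · simpa using hF₁
  · simpa using hF₂
  · exact fun i i' h hadj => h (hF _ (hBS i) _ (hBS i') hadj)
  · exact fun i j h hadj => h ((hF _ (hBS i) _ (hrS j) hadj).trans (hr j))
  · intro j j' hadj
    have h1 := hF _ (hrS j) _ (hrS j') hadj
    rw [hr, hr] at h1
    rw [Option.some_injective _ h1] at hadj
    exact G.irrefl hadj

/-- The bound on the distance spectral radius given by the average distance, for a graph with a
given number of components after deletion of `S`. -/
theorem Connected.le_distSpectralRadius_mul_card (hG : G.Connected) {S : Finset V}
    (hc : 0 < G.numCompDelete S) :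
    (Fintype.card V : ℝ) * (Fintype.card V - 1) + (G.numCompDelete S - 1) *
      (2 * (Fintype.card V - S.card) - G.numCompDelete S) ≤
      G.distSpectralRadius * Fintype.card V := by
  set c := G.numCompDelete S with hcdef
  have : Nonempty (Fin c) := ⟨⟨0, hc⟩⟩
  obtain ⟨F, hF, hsurj⟩ :=
    exists_coloring_of_le_numCompDelete (G := G) (S := S) (ι := Fin c) (by simp [hcdef])
  have h1 := G.sum_dist_mul_le fun _ => 1
  simp only [mul_one, one_pow, Finset.sum_const, Finset.card_univ, nsmul_eq_mul] at h1
  refine le_trans ?_ h1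
  let o : V → ℝ := fun v => if v ∈ S then 0 else 1
  let N : Fin c → ℝ := fun i => ∑ v, o v * if F v = i then 1 else 0
  have ho : ∀ v, 0 ≤ o v := fun v => by simp only [o]; split_ifs <;> norm_num
  have hosum : ∑ v, o v = Fintype.card V - S.card := by
    have : ∀ v, o v = 1 - if v ∈ S then 1 else 0 := fun v => by
      simp only [o]; split_ifs <;> norm_num
    simp [this, Finset.sum_sub_distrib]
  have hpt : ∀ u v, 1 - (if u = v then 1 else 0) + (o u * o v -
      ∑ i, (o u * if F u = i then 1 else 0) * (o v * if F v = i then 1 else 0)) ≤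
      (G.dist u v : ℝ) := by
    intro u v
    have hFs : ∑ i, (o u * if F u = i then 1 else 0) * (o v * if F v = i then 1 else 0) =
        o u * o v * if F u = F v then 1 else 0 := by
      simp only [mul_mul_mul_comm, ← Finset.mul_sum, ite_mul, one_mul, zero_mul,
        Finset.sum_ite_eq, Finset.mem_univ, if_true]
      simp only [eq_comm]
    rw [hFs]
    by_cases huv : u = v
    · simp [huv]
    · have hd := hG.one_le_dist huv
      by_cases hFuv : F u = F v
      · simpa [huv, hFuv] using hd
      · by_cases hu : u ∈ S
        · simpa [huv, hFuv, o, hu] using hd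
        · by_cases hv : v ∈ S
          · simpa [huv, hFuv, o, hv] using hd
          · have := hG.two_le_dist huv fun h => hFuv (hF u hu v hv h)
            simp [huv, hFuv, o, hu, hv]
            linarith
  have hsum := Finset.sum_le_sum fun u (_ : u ∈ Finset.univ) =>
    Finset.sum_le_sum fun v (_ : v ∈ Finset.univ) => hpt u v
  refine le_trans ?_ hsum
  have hN : ∑ u, ∑ v, ∑ i, (o u * if F u = i then 1 else 0) * (o v * if F v = i then 1 else 0) =
      ∑ i, N i ^ 2 := by
    simp only [N, sq, Finset.sum_mul_sum]
    exact (Finset.sum_congr rfl fun u _ => Finset.sum_comm).trans Finset.sum_comm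
  have hNsum : ∑ i, N i = Fintype.card V - S.card := by
    simp only [N]
    rw [Finset.sum_comm, ← hosum]
    exact Finset.sum_congr rfl fun v _ => by simp
  have hN1 : ∀ i, 0 ≤ N i - 1 := fun i => by
    obtain ⟨u, hu, hui⟩ := hsurj i
    have := Finset.single_le_sum (f := fun v => o v * if F v = i then 1 else 0)
      (fun v _ => mul_nonneg (ho v) (by split_ifs <;> norm_num)) (Finset.mem_univ u)
    simp only [o, hu, hui, if_true, if_false, mul_one] at this
    exact sub_nonneg.2 this
  -- The classes have size at least 1, so `∑ N i ^ 2` is largest when all but one are singletons.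
  have hsq := Finset.sum_sq_le_sq_sum_of_nonneg (s := Finset.univ) (f := fun i => N i - 1)
    (fun i _ => hN1 i)
  have hexp : ∑ i, (N i - 1) ^ 2 = ∑ i, N i ^ 2 - 2 * ∑ i, N i + c := by
    simp only [sub_sq, Finset.sum_add_distrib, Finset.sum_sub_distrib, Finset.mul_sum]
    simp
  rw [hexp, Finset.sum_sub_distrib, hNsum] at hsq
  simp only [Finset.sum_add_distrib, Finset.sum_sub_distrib, hN, ← Finset.mul_sum,
    ← Finset.sum_mul, hosum]
  simp at hsq ⊢
  nlinarith

end SimpleGraph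

/-! ### Numerical estimates and the two cases of the theorem. -/

namespace SimpleGraph

variable {V : Type*} [Fintype V] [DecidableEq V] {G : SimpleGraph V}

theorem three_mul_le_of_lt_mul {n s c t : ℕ} (ht : 0 < t) (hn : 4 * t ^ 2 + 10 * t ≤ n)
    (hc : 3 ≤ c) (hs : s < t * c) (hsc : s + c ≤ n) :
    (3 * n : ℝ) ≤ (c - 1) * (2 * (n - s) - c) := by
  have hs' : (s : ℝ) + 1 ≤ t * c := by exact_mod_cast hs
  have hsc' : (s : ℝ) + c ≤ n := by exact_mod_cast hsc
  have hc' : (3 : ℝ) ≤ c := by exact_mod_cast hc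
  have hn' : 4 * (t : ℝ) ^ 2 + 10 * t ≤ n := by exact_mod_cast hn
  have ht' : (1 : ℝ) ≤ t := by exact_mod_cast ht
  -- This is the case `c = 3`, `s = 3 * t - 1` of the claim; for `t = 1` it uses the whole
  -- hypothesis `n ≥ 14`.
  have hn12 : 12 * (t : ℝ) + 2 ≤ n := by
    rcases Nat.lt_or_ge 1 t with h | h
    · have : (2 : ℝ) ≤ t := by exact_mod_cast h
      nlinarith
    · have h1 : t = 1 := le_antisymm h ht
      subst h1
      norm_num at hn' ⊢
      linarith
  -- Which upper bound on `s` is sharper: `t * c - 1` or `n - c`.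
  by_cases hcase : (t + 1) * c ≤ n + 1
  · have hcase' : ((t : ℝ) + 1) * c ≤ n + 1 := by exact_mod_cast hcase
    have h1 : ((c : ℝ) - 1) * (2 * (n + 1 - t * c) - c) ≤ (c - 1) * (2 * (n - s) - c) :=
      mul_le_mul_of_nonneg_left (by linarith) (by linarith)
    refine le_trans ?_ h1
    obtain ⟨x, hx⟩ : ∃ x : ℝ, (c : ℝ) = 3 + x := ⟨c - 3, by ring⟩
    have hx0 : 0 ≤ x := by linarith
    rw [hx] at hcase' ⊢
    have h2 : 0 ≤ 2 * (n : ℝ) - 10 * t - 3 - (2 * t + 1) * x := by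
      -- For `x ≤ 4 * t` the bound on `n` in terms of `t` suffices; beyond that, `hcase'` takes
      -- over.
      rcases le_total x (4 * t) with h | h
      · nlinarith
      · nlinarith
    nlinarith [mul_nonneg hx0 h2]
  · have hcase' : (n : ℝ) + 2 ≤ (t + 1) * c := by exact_mod_cast not_le.1 hcase
    have h1 : ((c : ℝ) - 1) * c ≤ (c - 1) * (2 * (n - s) - c) :=
      mul_le_mul_of_nonneg_left (by linarith) (by linarith)
    refine le_trans ?_ h1
    have h2 : 3 * (t : ℝ) + 4 ≤ c := by
      by_contra! h
      have h3 : c < 3 * t + 4 := by exact_mod_cast h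
      have h4 : (c : ℝ) ≤ 3 * t + 3 := by exact_mod_cast Nat.lt_succ_iff.1 h3
      nlinarith
    nlinarith

theorem mul_le_of_mul_lt {n s c k : ℕ} (hk : 0 < k) (hkn : 4 + 9 * k ^ 2 + 9 * k ≤ 2 * k * n)
    (hs : 2 ≤ s) (hsc : s + c ≤ n) (hc : k * s < c) :
    (2 * k * (2 * n - 5 - 2 * k) : ℝ) ≤ (c - 1) * (2 * (n - s) - c) := by
  have hk' : (1 : ℝ) ≤ k := by exact_mod_cast hk
  have hkn' : 4 + 9 * (k : ℝ) ^ 2 + 9 * k ≤ 2 * k * n := by exact_mod_cast hkn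
  have hs' : (2 : ℝ) ≤ s := by exact_mod_cast hs
  have hsc' : (s : ℝ) + c ≤ n := by exact_mod_cast hsc
  have hc' : (k : ℝ) * s + 1 ≤ c := by exact_mod_cast hc
  -- The right side increases with `c` in the range `c ≤ n - s`, so `c` may be lowered to `k * s +
  -- 1`. The target is the value at `s = 2`, and the difference is `k * (s - 2)` times the quantity
  -- in `h3`.
  have h1 : (k * s : ℝ) * (2 * (n - s) - (k * s + 1)) ≤ (c - 1) * (2 * (n - s) - c) := by
    nlinarith [mul_nonneg (sub_nonneg.2 hc') (by linarith : (0 : ℝ) ≤ 2 * (n - s) - c - k * s)]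
  refine le_trans ?_ h1
  have h2 : 2 * (k : ℝ) + 4 + s ≤ n := by
    by_contra! h
    have h3 : n < 2 * k + 4 + s := by exact_mod_cast h
    have h4 : (n : ℝ) + 1 ≤ 2 * k + 4 + s := by exact_mod_cast h3
    nlinarith
  have h3 : 0 ≤ 2 * (n : ℝ) - 1 - (s + 2) * (k + 2) := by nlinarith
  nlinarith [mul_nonneg (mul_nonneg (by linarith : (0 : ℝ) ≤ k) (sub_nonneg.2 hs')) h3]

theorem cliqueJoin_one_distSpectralRadius_lt {n k : ℕ} (hk : 0 < k)
    (hkn : 4 + 9 * k ^ 2 + 9 * k ≤ 2 * k * n) :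
    (cliqueJoin 1 (n - 1 - k) k).distSpectralRadius <
      (n : ℝ) - 1 + 2 * k * (2 * n - 5 - 2 * k) / n := by
  have hk' : (1 : ℝ) ≤ k := by exact_mod_cast hk
  have hkn' : 4 + 9 * (k : ℝ) ^ 2 + 9 * k ≤ 2 * k * n := by exact_mod_cast hkn
  have hn : 9 / 2 * (k : ℝ) + 9 / 2 ≤ n := by nlinarith
  have hn0 : (0 : ℝ) < n := by linarith
  have hnk : k + 1 ≤ n := by
    have : (k : ℝ) + 1 ≤ n := by linarith
    exact_mod_cast this
  have hm : ((n - 1 - k : ℕ) : ℝ) = n - 1 - k := by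
    rw [Nat.cast_sub (by omega), Nat.cast_sub (by omega)]
    simp
  -- This `a` gives equality in the clique rows, with the bound taken to be the all-ones estimate at
  -- `s = 2`, `c = 2 * k + 1`.
  refine cliqueJoin_distSpectralRadius_lt one_pos hk (a := (5 * n - 10 - 4 * k) / (2 * n)) ?_ ?_ ?_
  · apply div_pos <;> linarith
  · rw [hm]
    refine le_of_eq ?_
    field_simp
    push_cast
    ring
  · rw [hm]
    obtain ⟨w, hw⟩ : ∃ w : ℝ, (n : ℝ) = 9 / 2 * k + 9 / 2 + w := ⟨n - (9 / 2 * k + 9 / 2), by ring⟩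
    have hw0 : 0 ≤ w := by linarith
    obtain ⟨l, hl⟩ : ∃ l : ℝ, (k : ℝ) = 1 + l := ⟨k - 1, by ring⟩
    have hl0 : 0 ≤ l := by linarith
    -- After shifting to `w, l ≥ 0`, positivity can be read off the expanded polynomial.
    have key : 0 ≤ (5 * (n : ℝ) - 10 - 4 * k) * (n ^ 2 + n + 2 * k * n - 10 * k - 4 * k ^ 2) -
        2 * n ^ 2 * (2 * n - 2 * k - 1) := by
      rw [hw, hl]
      ring_nf
      positivity
    have h2 : ((n : ℝ) - 1 + 2 * k * (2 * n - 5 - 2 * k) / n) * ((5 * n - 10 - 4 * k) / (2 * n)) -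
        (((1 : ℕ) : ℝ) + 2 * (n - 1 - k) + 2 * (k - 1) * ((5 * n - 10 - 4 * k) / (2 * n))) =
        ((5 * (n : ℝ) - 10 - 4 * k) * (n ^ 2 + n + 2 * k * n - 10 * k - 4 * k ^ 2) -
        2 * n ^ 2 * (2 * n - 2 * k - 1)) / (2 * n ^ 2) := by
      field_simp
      push_cast
      ring
    rw [← sub_nonneg, h2]
    positivity

theorem Connected.isTough_natCast_iff (hG : G.Connected) {n t : ℕ} (hV : Fintype.card V = n)
    (ht : 0 < t) (hn : 4 * t ^ 2 + 10 * t ≤ n)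
    (hle : G.distSpectralRadius ≤ (cliqueJoin (2 * t - 1) (n - 2 * t) 1).distSpectralRadius) :
    G.IsTough t ↔ ¬ Nonempty (G ≃g cliqueJoin (2 * t - 1) (n - 2 * t) 1) := by
  have hcast : ((2 * t - 1 : ℕ) : ℝ) = 2 * t - 1 := by
    rw [Nat.cast_sub (by omega)]; simp
  have ht0 : (0 : ℝ) < t := by exact_mod_cast ht
  have hn2 : 14 * t ≤ n := by nlinarith
  rw [← not_iff_not, not_not]
  constructor
  · intro h
    obtain ⟨S, hS, hSt⟩ := not_isTough_iff.1 h
    have hSt' : S.card < t * G.numCompDelete S := by exact_mod_cast hSt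
    rcases Nat.lt_or_ge 2 (G.numCompDelete S) with hc | hc
    · exfalso
      have h1 := hG.le_distSpectralRadius_mul_card (S := S) (by omega)
      have h2 := three_mul_le_of_lt_mul ht hn hc hSt' (hV ▸ G.card_add_numCompDelete_le S)
      have h3 : (cliqueJoin (2 * t - 1) (n - 2 * t) 1).distSpectralRadius < (n : ℝ) + 2 := by
        have hm : ((n - 2 * t : ℕ) : ℝ) = n - 2 * t := by
          rw [Nat.cast_sub (by omega)]; simp
        -- With `a = 2` the clique rows give exactly `n + 2`, matching the lower bound for `c ≥ 3`.
        refine cliqueJoin_distSpectralRadius_lt (by omega) one_pos (a := 2) two_pos ?_ ?_ <;>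
          rw [hcast, hm] <;> push_cast <;> linarith
      have hn0 : (0 : ℝ) < n := by exact_mod_cast (by omega : 0 < n)
      have h4 := mul_lt_mul_of_pos_right (hle.trans_lt h3) hn0
      rw [hV] at h1
      linarith
    · have hc2 : G.numCompDelete S = 2 := by omega
      rw [hc2] at hSt'
      -- Here `c = 2` only gives `|S| ≤ 2 * t - 1`; the comparison needs equality.
      obtain ⟨S', hS', hcut⟩ := (isCutSet_iff_one_lt_numCompDelete.2 hS).exists_superset_card_eq
        (r := 2 * t - 1) (by omega) (by omega)
      rw [isCutSet_iff_one_lt_numCompDelete] at hcut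
      exact hG.iso_cliqueJoin_of_le_numCompDelete (by omega) (by omega) one_pos (by omega) hS'
        hcut hle
  · rintro ⟨φ⟩
    refine not_isTough_of_iso_cliqueJoin (by omega) one_pos ht0 ?_ φ
    rw [hcast]
    push_cast
    linarith

theorem Connected.isTough_one_div_iff (hG : G.Connected) {n k : ℕ} {t : ℝ}
    (hV : Fintype.card V = n) (hk : 0 < k) (htk : 1 / t = k)
    (hn : 2 * t + 9 / (2 * t) + 9 / 2 ≤ n)
    (hle : G.distSpectralRadius ≤ (cliqueJoin 1 (n - 1 - k) k).distSpectralRadius) :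
    G.IsTough t ↔ ¬ Nonempty (G ≃g cliqueJoin 1 (n - 1 - k) k) := by
  have hk0 : (0 : ℝ) < k := by exact_mod_cast hk
  obtain rfl : t = 1 / k := by rw [← htk, one_div_one_div]
  have hkn' : 4 + 9 * (k : ℝ) ^ 2 + 9 * k ≤ 2 * k * n := by
    have h1 := mul_le_mul_of_nonneg_left hn (by positivity : (0 : ℝ) ≤ 2 * k)
    refine le_trans (le_of_eq ?_) h1
    field_simp
    ring
  have hkn : 4 + 9 * k ^ 2 + 9 * k ≤ 2 * k * n := by exact_mod_cast hkn'
  have hkn2 : 4 * k + 4 < n := by nlinarith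
  rw [← not_iff_not, not_not]
  constructor
  · intro h
    obtain ⟨S, hS, hSt⟩ := not_isTough_iff.1 h
    have hSt' : k * S.card < G.numCompDelete S := by
      rw [one_div_mul_eq_div, lt_div_iff₀ hk0] at hSt
      rw [mul_comm]
      exact_mod_cast hSt
    have hS0 := (hG.nonempty_of_isCutSet (isCutSet_iff_one_lt_numCompDelete.2 hS)).card_pos
    rcases Nat.lt_or_ge 1 S.card with hs | hs
    · exfalso
      have h1 := hG.le_distSpectralRadius_mul_card (S := S) (by omega)
      have h2 := mul_le_of_mul_lt hk hkn hs (hV ▸ G.card_add_numCompDelete_le S) hSt'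
      have hn0 : (0 : ℝ) < n := by exact_mod_cast (by omega : 0 < n)
      have h3 := mul_lt_mul_of_pos_right
        (hle.trans_lt (cliqueJoin_one_distSpectralRadius_lt hk hkn)) hn0
      rw [add_mul, div_mul_cancel₀ _ hn0.ne'] at h3
      rw [hV] at h1
      linarith
    · have hs1 : S.card = 1 := by omega
      rw [hs1] at hSt'
      exact hG.iso_cliqueJoin_of_le_numCompDelete one_pos (by omega) hk (by omega) hs1
        (by omega) hle
  · rintro ⟨φ⟩
    refine not_isTough_of_iso_cliqueJoin (by omega) hk (by positivity) ?_ φ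
    rw [one_div_mul_eq_div, lt_div_iff₀ hk0]
    push_cast
    linarith

end SimpleGraph

theorem theorem2 {V : Type*} [Fintype V] [DecidableEq V] (G : SimpleGraph V) (n : ℕ)
    (hG : G.Connected) (hn : Fintype.card V = n) :
    (∀ t : ℕ, 0 < t → 4 * t ^ 2 + 10 * t ≤ n →
      G.distSpectralRadius ≤
        (SimpleGraph.cliqueJoin (2 * t - 1) (n - 2 * t) 1).distSpectralRadius →
      (G.IsTough (t : ℝ) ↔
        ¬ Nonempty (G ≃g SimpleGraph.cliqueJoin (2 * t - 1) (n - 2 * t) 1))) ∧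
    (∀ (t : ℝ) (k : ℕ), 0 < k → 1 / t = (k : ℝ) →
      2 * t + 9 / (2 * t) + 9 / 2 ≤ (n : ℝ) →
      G.distSpectralRadius ≤
        (SimpleGraph.cliqueJoin 1 (n - 1 - k) k).distSpectralRadius →
      (G.IsTough t ↔
        ¬ Nonempty (G ≃g SimpleGraph.cliqueJoin 1 (n - 1 - k) k))) :=
  ⟨fun _ ht hnt hle => hG.isTough_natCast_iff hn ht hnt hle,
    fun _ _ hk htk hnt hle => hG.isTough_one_div_iff hn hk htk hnt hle⟩
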